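/- All graphs are finite and simple. For a graph $H$, let $\tau(H)$ be the minimum size of a vertex cover of $H$ (a set of vertices meeting every edge). A connected vertex cover of $H$ is a vertex cover $C$ of $H$ such that the induced subgraph $H[C]$ has the same number of connected components as $H$, where isolated vertices of $H$ are not counted as components of $H$ (so if $H$ is connected and has at least one edge, $H[C]$ must be connected, and if $H$ has no edge, $C$ must be empty); let $\tau_c(H)$ be the minimum size of a connected vertex cover of $H$. A graph is chordal if it has no induced cycle of length at least $4$, and $P_7$-free if it has no induced subgraph isomorphic to the path $P_7$ on $7$ vertices. If $G$ is a chordal, $P_7$-free graph, then every induced subgraph $H$ of $G$ satisfies $\tau_c(H) \leq \frac{3}{2}\,\tau(H)$. -/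

import Mathlib

open scoped ENNReal

namespace SimpleGraph

variable {V W : Type*}

/-- `G` is `H`-free: no induced subgraph of `G` is isomorphic to `H`. -/
def IndFree (G : SimpleGraph V) (H : SimpleGraph W) : Prop :=
  ¬ H.IsIndContained G

/-- A graph is chordal if it has no induced cycle on four or more vertices. -/
def IsChordal (G : SimpleGraph V) : Prop :=
  ∀ n : ℕ, 4 ≤ n → G.IndFree (cycleGraph n)

/-- A connected vertex cover of a (finite) graph `G`: a vertex cover `C` such that `G[C]` has the
same number of connected components as `G`, where isolated vertices of `G` (which have no edge to
cover) are not counted as components of `G`. Here `G.support` is the set of non-isolated vertices.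
For a connected graph `G` with at least one edge this says that `G[C]` is connected; for a graph
without edges only the empty set qualifies. -/
def IsConnectedVertexCover (G : SimpleGraph V) (C : Set V) : Prop :=
  G.IsVertexCover C ∧
    Nat.card (G.induce C).ConnectedComponent = Nat.card (G.induce G.support).ConnectedComponent

/-- The connected vertex cover number: the least size of a connected vertex cover. -/
noncomputable def connectedVertexCoverNum (G : SimpleGraph V) : ℕ∞ :=
  ⨅ (C : Set V) (_ : G.IsConnectedVertexCover C), C.encard

end SimpleGraph

/-! Among minimum vertex covers `C` and componentwise connected sets `D ⊇ C`, choose a pair with `D`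
smallest. It suffices to show that in each component of the graph, `D \ C` has at most half as many
vertices as `C`. By minimality each extra vertex `v ∈ D \ C` is a cut vertex of its part of `G[D]`.
`P₇`-freeness makes any two extra vertices of a component of `G` touch a common component of `G[C]`;
chordality upgrades this to one component `A` touched by all of them (`exists_center`). Each `v`
also touches a component other than `A`. Let `W v` be the vertices of `C` in these other components.
Chordality makes the sets `W v` disjoint (`eq_of_touches`). If `W v = {b}`, then `b` has a neighbour
outside `D`, since otherwise `v` could replace `b` (`exists_pendant`). Two such `v` would yield an
induced `P₇` through `A` (`eq_of_pendant`). So at most one `W v` is a singleton, and a vertex of `A`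
makes up for it. -/

namespace SimpleGraph

section

variable {V : Type*} {G : SimpleGraph V} {C D : Set V}

/-! ### Reachability inside a vertex set; finding induced paths and cycles. -/

/-- The graph on the vertices of `G` whose edges are the edges of `G` inside `X`. -/
def restrictTo (G : SimpleGraph V) (X : Set V) : SimpleGraph V where
  Adj a b := G.Adj a b ∧ a ∈ X ∧ b ∈ X
  symm := ⟨fun _ _ h => ⟨h.1.symm, h.2.2, h.2.1⟩⟩
  loopless := ⟨fun _ h => h.1.ne rfl⟩

theorem restrictTo_adj {X : Set V} {a b : V} :
    (G.restrictTo X).Adj a b ↔ G.Adj a b ∧ a ∈ X ∧ b ∈ X := Iff.rfl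

theorem restrictTo_mono {X Y : Set V} (h : X ⊆ Y) : G.restrictTo X ≤ G.restrictTo Y :=
  fun _ _ hab => ⟨hab.1, h hab.2.1, h hab.2.2⟩

theorem restrictTo_le (X : Set V) : G.restrictTo X ≤ G := fun _ _ h => h.1

theorem Reachable.invariant {P : V → Prop} {a b : V} (h : G.Reachable a b) (ha : P a)
    (hstep : ∀ s t, G.Adj s t → P s → P t) : P b := by
  obtain ⟨p⟩ := h
  induction p with
  | nil => exact ha
  | cons hadj _ ih => exact ih (hstep _ _ hadj ha)

theorem reachable_restrictTo_trans_adj {X : Set V} {a s t : V}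
    (h : (G.restrictTo X).Reachable a s) (hst : G.Adj s t) (hs : s ∈ X) (ht : t ∈ X) :
    (G.restrictTo X).Reachable a t :=
  h.trans (Adj.reachable ⟨hst, hs, ht⟩)

/-- A shortest path between two reachable vertices, as a sequence of vertices. -/
theorem Reachable.exists_geodesic {v w : V} (h : G.Reachable v w) :
    ∃ (m : ℕ) (f : ℕ → V), f 0 = v ∧ f m = w ∧ (∀ i < m, G.Adj (f i) (f (i + 1))) ∧
      (∀ i ≤ m, ∀ q : G.Walk v (f i), i ≤ q.length) := by
  obtain ⟨p, hp⟩ := h.exists_walk_length_eq_dist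
  refine ⟨p.length, p.getVert, p.getVert_zero, p.getVert_length,
    fun i hi => p.adj_getVert_succ hi, fun i hi q => ?_⟩
  -- A walk to `f i` shorter than `i`, followed by the rest of `p`, would beat the distance.
  have := dist_le (q.append (p.drop i))
  rw [Walk.length_append, Walk.drop_length] at this
  omega

/-- A shortest path between two reachable vertices is an induced path. -/
theorem Reachable.exists_induced_path {v w : V} (h : G.Reachable v w) :
    ∃ (m : ℕ) (f : ℕ → V), f 0 = v ∧ f m = w ∧
      (∀ i ≤ m, ∀ j ≤ m, G.Adj (f i) (f j) ↔ i + 1 = j ∨ j + 1 = i) ∧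
      (∀ i ≤ m, ∀ j ≤ m, f i = f j → i = j) := by
  obtain ⟨m, f, h0, hm, hadj, hmin⟩ := h.exists_geodesic
  have hwalk : ∀ i ≤ m, ∃ q : G.Walk v (f i), q.length = i := by
    intro i
    induction i with
    | zero => intro _; rw [h0]; exact ⟨.nil, rfl⟩
    | succ i ih =>
      intro hi
      obtain ⟨q, hq⟩ := ih (by omega)
      exact ⟨q.concat (hadj i (by omega)), by simp [hq]⟩
  have key : ∀ i ≤ m, ∀ j ≤ m, G.Adj (f i) (f j) → j ≤ i + 1 := by
    intro i hi j hj hij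
    obtain ⟨q, hq⟩ := hwalk i hi
    have := hmin j hj (q.concat hij)
    simpa [hq] using this
  have hle : ∀ i ≤ m, ∀ j ≤ m, f i = f j → j ≤ i := by
    intro i hi j hj hij
    obtain ⟨q, hq⟩ := hwalk i hi
    have := hmin j hj (q.copy rfl hij)
    simpa [hq] using this
  refine ⟨m, f, h0, hm, fun i hi j hj => ⟨fun hij => ?_, ?_⟩,
    fun i hi j hj hij => le_antisymm (hle j hj i hi hij.symm) (hle i hi j hj hij)⟩
  · have h1 := key i hi j hj hij
    have h2 := key j hj i hi hij.symm
    have : i ≠ j := fun h => hij.ne (by rw [h])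
    omega
  · rintro (rfl | rfl)
    · exact hadj i (by omega)
    · exact (hadj j (by omega)).symm

/-- A `P₇`-free graph has no seven-level structure with a path from the bottom to the top level. -/
theorem IndFree.false_of_levels (hP7 : G.IndFree (pathGraph 7)) {X : Set V} {v w : V}
    (h : (G.restrictTo X).Reachable v w) (hv : v ∈ X) (φ : V → ℕ)
    (hφ : ∀ s ∈ X, ∀ t ∈ X, G.Adj s t → φ t ≤ φ s + 1) (hvw : φ v + 6 ≤ φ w) : False := by
  obtain ⟨m, f, h0, hm, hadj, hinj⟩ := h.exists_induced_path
  have hφ' : ∀ i ≤ m, φ (f i) ≤ φ v + i := by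
    intro i
    induction i with
    | zero => simp [h0]
    | succ i ih =>
      intro hi
      have hst := (hadj i (by omega) (i + 1) hi).2 (Or.inl rfl)
      have := hφ _ hst.2.1 _ hst.2.2 hst.1
      have := ih (by omega)
      omega
  -- Each edge raises the level by at most one, so the induced path has at least six edges; its
  -- first seven vertices form an induced `P₇`.
  have h6 : 6 ≤ m := by
    have := hφ' m le_rfl
    rw [hm] at this
    omega
  have hX : ∀ i ≤ m, f i ∈ X := by
    intro i hi
    rcases i with _ | i
    · rwa [h0]
    · exact ((hadj i (by omega) (i + 1) hi).2 (Or.inl rfl)).2.2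
  refine hP7 ⟨⟨⟨fun i : Fin 7 => f i.val, fun i j hij => ?_⟩, ?_⟩⟩
  · exact Fin.ext (hinj _ (by omega) _ (by omega) hij)
  · intro i j
    have := hadj i.val (by omega) j.val (by omega)
    rw [pathGraph_adj, ← this, restrictTo_adj]
    exact ⟨fun h => ⟨h, hX i.val (by omega), hX j.val (by omega)⟩, And.left⟩

/-- In a chordal graph, two non-adjacent vertices cannot be joined through two disjoint sets
without edges between them. -/
theorem IsChordal.false_of_two_paths (hG : G.IsChordal) {X Y : Set V} {v w : V} (hvw : v ≠ w)
    (hnadj : ¬ G.Adj v w) (hdisj : ∀ x ∈ X, x ∉ Y) (hXY : ∀ x ∈ X, ∀ y ∈ Y, ¬ G.Adj x y)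
    (hX : (G.restrictTo (insert v (insert w X))).Reachable v w)
    (hY : (G.restrictTo (insert v (insert w Y))).Reachable v w) : False := by
  have main : ∀ Z : Set V, (G.restrictTo (insert v (insert w Z))).Reachable v w →
      ∃ (m : ℕ) (f : ℕ → V), 2 ≤ m ∧ f 0 = v ∧ f m = w ∧ (∀ i, 0 < i → i < m → f i ∈ Z) ∧
      (∀ i ≤ m, ∀ j ≤ m, G.Adj (f i) (f j) ↔ i + 1 = j ∨ j + 1 = i) ∧
      (∀ i ≤ m, ∀ j ≤ m, f i = f j → i = j) := by
    intro Z hZ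
    obtain ⟨m, f, h0, hm, hadj, hinj⟩ := hZ.exists_induced_path
    have hmem : ∀ i ≤ m, f i ∈ insert v (insert w Z) := by
      intro i hi
      rcases i with _ | i
      · simp [h0]
      · exact ((hadj i (by omega) (i + 1) hi).2 (Or.inl rfl)).2.2
    have hadj' : ∀ i ≤ m, ∀ j ≤ m, G.Adj (f i) (f j) ↔ i + 1 = j ∨ j + 1 = i := by
      intro i hi j hj
      rw [← hadj i hi j hj, restrictTo_adj]
      exact ⟨fun h => ⟨h, hmem i hi, hmem j hj⟩, And.left⟩
    refine ⟨m, f, ?_, h0, hm, ?_, hadj', hinj⟩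
    · by_contra hlt
      obtain rfl | rfl : m = 0 ∨ m = 1 := by omega
      · exact hvw (h0.symm.trans hm)
      · exact hnadj (by rw [← h0, ← hm]; exact (hadj' 0 (by omega) 1 le_rfl).2 (Or.inl rfl))
    · intro i h1 h2
      rcases hmem i h2.le with h | h | h
      · have := hinj i h2.le 0 (by omega) (h.trans h0.symm)
        omega
      · have := hinj i h2.le m le_rfl (h.trans hm.symm)
        omega
      · exact h
  obtain ⟨m, f, hm2, hf0, hfm, hfX, hfadj, hfinj⟩ := main X hX
  obtain ⟨n, g, hn2, hg0, hgn, hgY, hgadj, hginj⟩ := main Y hY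
  -- The two induced paths meet only at `v` and `w`, and no edge joins their interiors.
  have hcross : ∀ i ≤ m, ∀ j, 0 < j → j < n → f i ≠ g j ∧
      (G.Adj (f i) (g j) ↔ (i = 0 ∧ j = 1) ∨ (i = m ∧ j + 1 = n)) := by
    intro i hi j hj0 hjn
    rcases Nat.eq_zero_or_pos i with rfl | hi0
    · rw [hf0, ← hg0, hgadj 0 (by omega) j (by omega)]
      refine ⟨fun h => ?_, by omega⟩
      have := hginj 0 (by omega) j (by omega) h
      omega
    · rcases eq_or_lt_of_le hi with rfl | him
      · rw [hfm, ← hgn, hgadj n (by omega) j (by omega)]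
        refine ⟨fun h => ?_, by omega⟩
        have := hginj n (by omega) j (by omega) h
        omega
      · have h1 := hfX i hi0 him
        have h2 := hgY j hj0 hjn
        refine ⟨fun h => hdisj _ h1 (h ▸ h2), ?_⟩
        have := hXY _ h1 _ h2
        simp only [this, false_iff]
        omega
  -- Forward along `f` from `v` to `w`, then back along the interior of `g`.
  let c : Fin (m + n) → V := fun k => if k.val ≤ m then f k.val else g (m + n - k.val)
  refine hG (m + n) (by omega) ⟨⟨⟨c, fun k l hkl => ?_⟩, ?_⟩⟩
  · have hk := k.isLt
    have hl := l.isLt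
    apply Fin.ext
    by_cases h1 : k.val ≤ m <;> by_cases h2 : l.val ≤ m <;>
      simp only [c, h1, h2, if_true, if_false] at hkl
    · exact hfinj _ h1 _ h2 hkl
    · exact absurd hkl (hcross _ h1 _ (by omega) (by omega)).1
    · exact absurd hkl.symm (hcross _ h2 _ (by omega) (by omega)).1
    · have := hginj _ (by omega) _ (by omega) hkl
      omega
  · intro k l
    have hk := k.isLt
    have hl := l.isLt
    -- Subtraction in `Fin` is modular; the second alternative is the closing edge of the cycle.
    have hsub : ∀ a b : Fin (m + n), (a - b).val = 1 ↔
        a.val = b.val + 1 ∨ (a.val = 0 ∧ b.val + 1 = m + n) := by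
      intro a b
      have ha := a.isLt
      have hb := b.isLt
      rw [Fin.val_sub]
      by_cases hab : b.val ≤ a.val
      · have : m + n - b.val + a.val = (a.val - b.val) + (m + n) := by omega
        rw [this, Nat.add_mod_right, Nat.mod_eq_of_lt (by omega)]
        omega
      · rw [Nat.mod_eq_of_lt (by omega)]
        omega
    rw [cycleGraph_adj', hsub, hsub]
    change G.Adj (c k) (c l) ↔ _
    by_cases h1 : k.val ≤ m <;> by_cases h2 : l.val ≤ m <;>
      simp only [c, h1, h2, if_true, if_false]
    · rw [hfadj _ h1 _ h2]
      omega
    · rw [(hcross _ h1 _ (by omega) (by omega)).2]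
      omega
    · rw [G.adj_comm, (hcross _ h2 _ (by omega) (by omega)).2]
      omega
    · rw [hgadj _ (by omega) _ (by omega)]
      omega

/-! ### Optimal extensions and the components of the cover. -/

/-- `D` has no isolated vertices of `G`, and any two of its vertices in the same component of `G`
are joined by a path inside `D`. -/
def IsComponentwiseConnected (G : SimpleGraph V) (D : Set V) : Prop :=
  D ⊆ G.support ∧ ∀ x ∈ D, ∀ y ∈ D, G.Reachable x y → (G.restrictTo D).Reachable x y

/-- `D` is a smallest componentwise connected set containing a vertex cover of the size of `C`,
and it contains the vertex cover `C`. -/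
structure IsOptimalExtension (G : SimpleGraph V) (C D : Set V) : Prop where
  cover : G.IsVertexCover C
  subset : C ⊆ D
  conn : G.IsComponentwiseConnected D
  le : ∀ C' D' : Set V, G.IsVertexCover C' → C'.ncard = C.ncard → C' ⊆ D' →
    G.IsComponentwiseConnected D' → D.ncard ≤ D'.ncard

/-- `v` has a neighbour in the component of `a` in `G[C]`. -/
def Touches (G : SimpleGraph V) (C : Set V) (v a : V) : Prop :=
  ∃ c ∈ C, (G.restrictTo C).Reachable a c ∧ G.Adj v c

theorem Touches.congr {v a b : V} (h : G.Touches C v a) (hab : (G.restrictTo C).Reachable a b) :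
    G.Touches C v b :=
  let ⟨c, hc, hac, hvc⟩ := h
  ⟨c, hc, hab.symm.trans hac, hvc⟩

theorem Touches.reachable {v a : V} (h : G.Touches C v a) : G.Reachable v a :=
  let ⟨_, _, hac, hvc⟩ := h
  hvc.reachable.trans (hac.mono (restrictTo_le _)).symm

theorem IsVertexCover.mem_of_adj (hC : G.IsVertexCover C) {v c : V} (hv : v ∉ C)
    (h : G.Adj v c) : c ∈ C :=
  (hC h).resolve_left hv

theorem IsVertexCover.touches_of_adj (hC : G.IsVertexCover C) {v c : V} (hv : v ∉ C)
    (h : G.Adj v c) : G.Touches C v c :=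
  ⟨c, hC.mem_of_adj hv h, .rfl, h⟩

theorem reachable_restrictTo_component {a c : V}
    (h : (G.restrictTo C).Reachable a c) :
    (G.restrictTo {x ∈ C | (G.restrictTo C).Reachable a x}).Reachable a c := by
  refine (h.invariant (P := fun z => (G.restrictTo C).Reachable a z ∧
    (G.restrictTo {x ∈ C | (G.restrictTo C).Reachable a x}).Reachable a z) ⟨.rfl, .rfl⟩ ?_).2
  rintro s t hst ⟨h1, h2⟩
  have h3 := h1.trans hst.reachable
  exact ⟨h3, reachable_restrictTo_trans_adj h2 hst.1 ⟨hst.2.1, h1⟩ ⟨hst.2.2, h3⟩⟩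

theorem Touches.reachable_restrictTo {v a : V} {X : Set V} (h : G.Touches C v a)
    (hv : v ∈ X) (hX : ∀ x ∈ C, (G.restrictTo C).Reachable a x → x ∈ X) :
    (G.restrictTo X).Reachable v a := by
  obtain ⟨c, hc, hac, hvc⟩ := h
  have h1 : (G.restrictTo X).Adj v c := ⟨hvc, hv, hX c hc hac⟩
  exact h1.reachable.trans ((reachable_restrictTo_component hac).mono
    (restrictTo_mono fun x hx => hX x hx.1 hx.2)).symm

/-- In a chordal graph, two vertices outside a vertex cover have at most one component of the
vertex cover in common. -/
theorem IsChordal.eq_of_touches (hG : G.IsChordal) (hC : G.IsVertexCover C) {v w a b : V}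
    (hv : v ∉ C) (hw : w ∉ C) 
    (hab : ¬ (G.restrictTo C).Reachable a b) (hva : G.Touches C v a) (hwa : G.Touches C w a)
    (hvb : G.Touches C v b) (hwb : G.Touches C w b) : v = w := by
  by_contra hvw
  have key : ∀ d, G.Touches C v d → G.Touches C w d → (G.restrictTo (insert v (insert w
      {x ∈ C | (G.restrictTo C).Reachable d x}))).Reachable v w := by
    intro d h1 h2
    exact (h1.reachable_restrictTo (by simp) fun x hx h => by simp [hx, h]).trans
      (h2.reachable_restrictTo (by simp) fun x hx h => by simp [hx, h]).symm
  refine hG.false_of_two_paths hvw (fun h => hw (hC.mem_of_adj hv h)) ?_ ?_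
    (key a hva hwa) (key b hvb hwb)
  · exact fun x hx hy => hab (hx.2.trans hy.2.symm)
  · exact fun x hx y hy h =>
      hab ((reachable_restrictTo_trans_adj hx.2 h hx.1 hy.1).trans hy.2.symm)

/-- Otherwise `D \ {v}` would still contain `C` and be componentwise connected, contradicting
minimality. -/
theorem IsOptimalExtension.exists_separated [Finite V] (h : G.IsOptimalExtension C D) {v : V}
    (hv : v ∈ D) (hvC : v ∉ C) (w : V) :
    ∃ s ∈ D, s ≠ v ∧ G.Reachable v s ∧ ¬ (G.restrictTo (D \ {v})).Reachable s w := by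
  by_contra! hcon
  have hlt : (D \ {v}).ncard < D.ncard := Set.ncard_sdiff_singleton_lt_of_mem hv
  refine absurd (h.le C (D \ {v}) h.cover rfl (fun c hc => ⟨h.subset hc, fun hcv => ?_⟩)
    ⟨fun x hx => h.conn.1 hx.1, fun x hx y hy hxy => ?_⟩) (not_le.2 hlt)
  · rw [Set.mem_singleton_iff] at hcv
    exact hvC (hcv ▸ hc)
  · by_cases hvx : G.Reachable v x
    · exact (hcon x hx.1 hx.2 hvx).trans (hcon y hy.1 hy.2 (hvx.trans hxy)).symm
    -- Outside the component of `v`, no walk passes through `v`.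
    · refine ((h.conn.2 x hx.1 y hy.1 hxy).invariant
        (P := fun z => (G.restrictTo (D \ {v})).Reachable x z) .rfl fun s t hst hs => ?_)
      have hxs : G.Reachable x s := hs.mono (restrictTo_le _)
      refine reachable_restrictTo_trans_adj hs hst.1 ⟨hst.2.1, ?_⟩ ⟨hst.2.2, ?_⟩
      · rintro rfl
        exact hvx hxs.symm
      · rintro rfl
        exact hvx (hxs.trans hst.1.reachable).symm

open Classical in
/-- In a `P₇`-free graph, any two additional vertices of an optimal extension in the same component
of the graph are adjacent to a common component of the vertex cover. -/
theorem IsOptimalExtension.exists_touches_touches [Finite V] (h : G.IsOptimalExtension C D)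
    (hP7 : G.IndFree (pathGraph 7)) {v w : V} (hv : v ∈ D) (hvC : v ∉ C) (hw : w ∈ D)
    (hwC : w ∉ C) (hvw : G.Reachable v w) :
    ∃ a ∈ C, G.Touches C v a ∧ G.Touches C w a := by
  have hC := h.cover
  rcases eq_or_ne v w with rfl | hne
  · obtain ⟨c, hc⟩ := h.conn.1 hv
    have hcv := hC.touches_of_adj hvC hc
    exact ⟨c, hC.mem_of_adj hvC hc, hcv, hcv⟩
  by_contra! hcon
  -- `S v w` is the part of `D` in the component of `v` that deleting `v` cuts off from `w`.
  obtain ⟨S, hS⟩ : ∃ S : V → V → Set V, ∀ v w s, s ∈ S v w ↔ (s ∈ D ∧ s ≠ v ∧ G.Reachable v s ∧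
      ¬ (G.restrictTo (D \ {v})).Reachable s w) :=
    ⟨fun v w => {s | s ∈ D ∧ s ≠ v ∧ G.Reachable v s ∧
      ¬ (G.restrictTo (D \ {v})).Reachable s w}, fun _ _ _ => Iff.rfl⟩
  have hstep : ∀ v w s t, s ∈ S v w → t ∈ D → t ≠ v → G.Adj s t → t ∈ S v w := by
    intro v w s t hs ht htv hst
    obtain ⟨hs, hsv, hvs, hsw⟩ := (hS v w s).1 hs
    refine (hS v w t).2 ⟨ht, htv, hvs.trans hst.reachable, fun htw => hsw ?_⟩
    have : (G.restrictTo (D \ {v})).Adj s t := ⟨hst, ⟨hs, hsv⟩, ⟨ht, htv⟩⟩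
    exact this.reachable.trans htw
  have hnot : ∀ v w, w ∉ S v w := fun v w hw => ((hS _ _ _).1 hw).2.2.2 .rfl
  have hself : ∀ v w, v ∉ S v w := fun v w hv => ((hS _ _ _).1 hv).2.1 rfl
  -- The intersection is closed under adjacency in `D`, so a walk from it to `v` would put `v`
  -- itself in `S v w`.
  have hdisj : ∀ s, s ∈ S v w → s ∉ S w v := by
    rintro s h1 h2
    obtain ⟨hsD, -, hvs, -⟩ := (hS _ _ _).1 h1
    refine hself v w ((h.conn.2 s hsD v hv hvs.symm).invariant
      (P := fun z => z ∈ S v w ∧ z ∈ S w v) ⟨h1, h2⟩ ?_).1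
    rintro s t hst ⟨h1, h2⟩
    have htv : t ≠ v := by
      rintro rfl
      exact hnot w t (hstep w t s t h2 hst.2.2 hne hst.1)
    have htw : t ≠ w := by
      rintro rfl
      exact hnot v t (hstep v t s t h1 hst.2.2 htv hst.1)
    exact ⟨hstep _ _ _ _ h1 hst.2.2 htv hst.1, hstep _ _ _ _ h2 hst.2.2 htw hst.1⟩
  obtain ⟨N, hNmem⟩ : ∃ N : V → Set V, ∀ v c, c ∈ N v ↔ c ∈ C ∧ G.Touches C v c :=
    ⟨fun v => {c | c ∈ C ∧ G.Touches C v c}, fun _ _ => Iff.rfl⟩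
  have hN : ∀ v, v ∉ C → ∀ c, G.Adj v c → c ∈ N v := fun v hv c hc =>
    (hNmem v c).2 ⟨hC.mem_of_adj hv hc, hC.touches_of_adj hv hc⟩
  have hNN : ∀ v s t, s ∈ N v → t ∈ C → G.Adj s t → t ∈ N v := fun v s t hs ht hst =>
    have hs := (hNmem v s).1 hs
    (hNmem v t).2 ⟨ht, hs.2.congr (Adj.reachable ⟨hst, hs.1, ht⟩)⟩
  have hNd : ∀ s, s ∈ N v → s ∉ N w := fun s h1 h2 =>
    hcon s ((hNmem v s).1 h1).1 ((hNmem v s).1 h1).2 ((hNmem w s).1 h2).2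
  have hNC : ∀ v s, s ∈ N v → s ∈ C := fun v s hs => ((hNmem v s).1 hs).1
  obtain ⟨x, hx⟩ : ∃ x, x ∈ S v w :=
    let ⟨x, h1, h2, h3, h4⟩ := h.exists_separated hv hvC w
    ⟨x, (hS _ _ _).2 ⟨h1, h2, h3, h4⟩⟩
  obtain ⟨y, hy⟩ : ∃ y, y ∈ S w v :=
    let ⟨y, h1, h2, h3, h4⟩ := h.exists_separated hw hwC v
    ⟨y, (hS _ _ _).2 ⟨h1, h2, h3, h4⟩⟩
  obtain ⟨hxD, -, hvx, -⟩ := (hS _ _ _).1 hx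
  obtain ⟨hyD, -, hwy, -⟩ := (hS _ _ _).1 hy
  have hxy : (G.restrictTo D).Reachable x y :=
    h.conn.2 x hxD y hyD (hvx.symm.trans (hvw.trans hwy))
  -- Levels 0 to 6 are `S v w`, `v`, `N v`, the rest, `N w`, `w`, `S w v`. With no common component,
  -- no edge inside `D` climbs more than one level.
  let φ : V → ℕ := fun z => if z ∈ S v w then 0 else if z = v then 1 else if z ∈ S w v then 6
    else if z = w then 5 else if z ∈ N v then 2 else if z ∈ N w then 4 else 3
  have hφ : ∀ z, (z ∈ S v w ∧ φ z = 0) ∨ (z = v ∧ φ z = 1) ∨ (z ∈ S w v ∧ φ z = 6) ∨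
      (z = w ∧ φ z = 5) ∨ (z ∉ S v w ∧ z ≠ v ∧ z ∉ S w v ∧ z ≠ w ∧ ((z ∈ N v ∧ φ z = 2) ∨
        (z ∈ N w ∧ φ z = 4) ∨ (z ∉ N v ∧ z ∉ N w ∧ φ z = 3))) := by
    intro z
    simp only [φ]
    split_ifs <;> simp_all
  refine hP7.false_of_levels hxy hxD φ ?_ ?_
  · intro s hs t ht hst
    have e1 := hstep v w s t
    have e2 := hstep w v s t
    have e1' := hstep v w t s
    have e2' := hstep w v t s
    have e3 := hnot v w
    have e4 := hnot w v
    have e5 := hself v w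
    have e6 := hself w v
    have e7 := hdisj s
    have e8 := hdisj t
    have e9 := hN v hvC
    have e10 := hN w hwC
    have e11 := hNd s
    have e12 := hNd t
    have e13 := hNN v s t
    have e14 := hNN v t s
    have e15 := hNN w s t
    have e16 := hNN w t s
    have e17 := hNC v
    have e18 := hNC w
    have hts := hst.symm
    have e19 := @hC s t hst
    have hφs := hφ s
    have hφt := hφ t
    clear_value φ
    clear hS hNmem hstep hnot hself hdisj hN hNN hNd hNC hφ hcon
    rcases hφs with hφs | hφs | hφs | hφs | ⟨_, _, _, _, hφs | hφs | hφs⟩ <;>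
    rcases hφt with hφt | hφt | hφt | hφt | ⟨_, _, _, _, hφt | hφt | hφt⟩ <;>
    first | omega | grind
  · have := hdisj y
    have := hself w v
    simp only [φ]
    grind

/-- In a chordal `P₇`-free graph, the additional vertices of an optimal extension that lie in the
same component of the graph are all adjacent to a common component of the vertex cover. -/
theorem IsOptimalExtension.exists_center [Finite V] (h : G.IsOptimalExtension C D)
    (hG : G.IsChordal) (hP7 : G.IndFree (pathGraph 7)) {v : V} (hv : v ∈ D) (hvC : v ∉ C) :
    ∃ a ∈ C, ∀ u ∈ D, u ∉ C → G.Reachable v u → G.Touches C u a := by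
  have hC := h.cover
  by_cases hex : ∃ w ∈ D, w ∉ C ∧ G.Reachable v w ∧ v ≠ w
  swap
  · push Not at hex
    obtain ⟨a, ha, hva, -⟩ := h.exists_touches_touches hP7 hv hvC hv hvC .rfl
    exact ⟨a, ha, fun u hu huC hvu => hex u hu huC hvu ▸ hva⟩
  obtain ⟨w, hw, hwC, hvw, hne⟩ := hex
  obtain ⟨a, ha, hva, hwa⟩ := h.exists_touches_touches hP7 hv hvC hw hwC hvw
  refine ⟨a, ha, fun u hu huC hvu => ?_⟩
  by_contra hua
  obtain ⟨b, hb, hvb, hub⟩ := h.exists_touches_touches hP7 hv hvC hu huC hvu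
  obtain ⟨c, hc, hwc, huc⟩ := h.exists_touches_touches hP7 hw hwC hu huC (hvw.symm.trans hvu)
  -- A Helly argument: if `u` misses the component of `a`, then `v` and `w` are joined both through
  -- that component and through those of `b` and `c` via `u`.
  refine hG.false_of_two_paths (X := {x ∈ C | (G.restrictTo C).Reachable a x})
    (Y := insert u {x ∈ C | (G.restrictTo C).Reachable b x ∨ (G.restrictTo C).Reachable c x})
    hne (fun h => hwC (hC.mem_of_adj hvC h)) ?_ ?_ ?_ ?_
  · rintro x ⟨hx, hax⟩ (rfl | ⟨-, hbx | hcx⟩)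
    · exact huC hx
    · exact hua (hub.congr (hbx.trans hax.symm))
    · exact hua (huc.congr (hcx.trans hax.symm))
  · rintro x ⟨hx, hax⟩ y (rfl | ⟨hy, hby | hcy⟩) hxy
    · exact hua ⟨x, hx, hax, hxy.symm⟩
    · exact hua (hub.congr (hby.trans (reachable_restrictTo_trans_adj hax hxy hx hy).symm))
    · exact hua (huc.congr (hcy.trans (reachable_restrictTo_trans_adj hax hxy hx hy).symm))
  · exact (hva.reachable_restrictTo (by simp) fun x hx h => by simp [hx, h]).trans
      (hwa.reachable_restrictTo (by simp) fun x hx h => by simp [hx, h]).symm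
  · exact ((hvb.reachable_restrictTo (by simp) fun x hx h => by simp [hx, h]).trans
      (hub.reachable_restrictTo (by simp) fun x hx h => by simp [hx, h]).symm).trans
      ((huc.reachable_restrictTo (by simp) fun x hx h => by simp [hx, h]).trans
      (hwc.reachable_restrictTo (by simp) fun x hx h => by simp [hx, h]).symm)

/-! ### Extra vertices with a single private cover vertex. -/

/-- If an additional vertex `v` of an optimal extension has only one vertex `b` outside the central
component to connect, then `b` has a neighbour outside the extension. -/
theorem IsOptimalExtension.exists_pendant [Finite V] (h : G.IsOptimalExtension C D)
    (hG : G.IsChordal) {v a b : V} (hv : v ∈ D) (hvC : v ∉ C)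
    (hcenter : ∀ u ∈ D, u ∉ C → G.Reachable v u → G.Touches C u a) (hb : b ∈ C)
    (hab : ¬ (G.restrictTo C).Reachable a b) (hvb : G.Touches C v b)
    (huniq : ∀ c ∈ C, ¬ (G.restrictTo C).Reachable a c → G.Touches C v c → c = b) :
    G.Adj v b ∧ ∃ p, p ∉ D ∧ G.Adj b p := by
  have hC := h.cover
  have hva := hcenter v hv hvC .rfl
  have hadj : G.Adj v b := by
    obtain ⟨c, hc, hbc, hvc⟩ := hvb
    rwa [← huniq c hc (fun hac => hab (hac.trans hbc.symm)) (hC.touches_of_adj hvC hvc)]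
  have hnbr : ∀ u ∈ D, G.Adj b u → u = v := by
    intro u hu hbu
    by_cases huC : u ∈ C
    · have hr : (G.restrictTo C).Adj b u := ⟨hbu, hb, huC⟩
      have := huniq u huC (fun hau => hab (hau.trans hr.reachable.symm)) (hvb.congr hr.reachable)
      exact absurd this.symm hbu.ne
    · exact hG.eq_of_touches hC huC hvC hab
        (hcenter u hu huC (hadj.reachable.trans hbu.reachable)) hva
        (hC.touches_of_adj huC hbu.symm) hvb
  refine ⟨hadj, ?_⟩
  by_contra! hcon
  have hnbr' : ∀ u, G.Adj b u → u = v := fun u hbu =>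
    hnbr u (by_contra fun hu => hcon u hu hbu) hbu
  have hbD := h.subset hb
  have hlt : (D \ {b}).ncard < D.ncard := Set.ncard_sdiff_singleton_lt_of_mem hbD
  -- Now `b` is a leaf at `v`: exchanging `b` for `v` keeps a cover of the same size, and `b` can
  -- leave `D`. This is why optimality compares different covers.
  refine absurd (h.le (insert v (C \ {b})) (D \ {b}) ?_ (Set.ncard_exchange hvC hb) ?_
    ⟨fun x hx => h.conn.1 hx.1, fun x hx y hy hxy => ?_⟩) (not_le.2 hlt)
  · intro s t hst
    have h1 := hC hst
    have h2 := hnbr' s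
    have h3 := hnbr' t
    have h4 := hst.symm
    grind
  · have := h.subset
    have := hadj.ne
    grind
  -- A walk visiting the leaf `b` enters and leaves through `v`, so while at `b` reachability of `v`
  -- is recorded instead.
  · have key := (h.conn.2 x hx.1 y hy.1 hxy).invariant
      (P := fun z => (z = b ∧ (G.restrictTo (D \ {b})).Reachable x v) ∨
        (z ≠ b ∧ (G.restrictTo (D \ {b})).Reachable x z)) (Or.inr ⟨hx.2, .rfl⟩) ?_
    · exact (key.resolve_left fun h => hy.2 h.1).2
    · rintro s t hst (⟨rfl, hs⟩ | ⟨hsb, hs⟩)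
      · have := hnbr' t hst.1
        subst this
        exact Or.inr ⟨hst.1.ne', hs⟩
      · by_cases htb : t = b
        · subst htb
          have := hnbr' s hst.1.symm
          subst this
          exact Or.inl ⟨rfl, hs⟩
        · exact Or.inr ⟨htb,
            reachable_restrictTo_trans_adj hs hst.1 ⟨hst.2.1, hsb⟩ ⟨hst.2.2, htb⟩⟩

open Classical in
/-- In a chordal `P₇`-free graph, two pendant paths of length two cannot hang at different
neighbours of the same component of the vertex cover. -/
theorem IsChordal.eq_of_pendant (hG : G.IsChordal) (hP7 : G.IndFree (pathGraph 7))
    (hC : G.IsVertexCover C) (hCD : C ⊆ D) {v w a b c p q : V} (hv : v ∈ D) (hvC : v ∉ C)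
    (hw : w ∈ D) (hwC : w ∉ C) (hva : G.Touches C v a) (hwa : G.Touches C w a) (hb : b ∈ C)
    (hc : c ∈ C) (hab : ¬ (G.restrictTo C).Reachable a b) (hac : ¬ (G.restrictTo C).Reachable a c)
    (hvb : G.Adj v b) (hwc : G.Adj w c) (hp : p ∉ D) (hbp : G.Adj b p) (hq : q ∉ D)
    (hcq : G.Adj c q) : v = w := by
  by_contra hvw
  have hpC : p ∉ C := fun h => hp (hCD h)
  have hqC : q ∉ C := fun h => hq (hCD h)
  have hpa : ¬ G.Touches C p a := fun hpa => hp (hG.eq_of_touches hC hpC hvC hab hpa hva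
    (hC.touches_of_adj hpC hbp.symm) (hC.touches_of_adj hvC hvb) ▸ hv)
  have hqa : ¬ G.Touches C q a := fun hqa => hq (hG.eq_of_touches hC hqC hwC hac hqa hwa
    (hC.touches_of_adj hqC hcq.symm) (hC.touches_of_adj hwC hwc) ▸ hw)
  have hbc : ¬ (G.restrictTo C).Reachable b c := fun hbc =>
    hvw (hG.eq_of_touches hC hvC hwC hab hva hwa (hC.touches_of_adj hvC hvb)
      ((hC.touches_of_adj hwC hwc).congr hbc.symm))
  have hbw : ¬ G.Adj b w := fun hbw =>
    hvw (hG.eq_of_touches hC hvC hwC hab hva hwa (hC.touches_of_adj hvC hvb)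
      (hC.touches_of_adj hwC hbw.symm))
  have hcv : ¬ G.Adj c v := fun hcv =>
    hvw (hG.eq_of_touches hC hvC hwC hac hva hwa (hC.touches_of_adj hvC hcv.symm)
      (hC.touches_of_adj hwC hwc))
  have hone : ∀ {s t}, s ∈ C → t ∈ C → G.Adj s t → (G.restrictTo C).Reachable s t :=
    fun hs ht hst => Adj.reachable ⟨hst, hs, ht⟩
  have hind : ∀ {s t}, s ∉ C → t ∉ C → ¬ G.Adj s t := fun hs ht hst => ht (hC.mem_of_adj hs hst)
  -- Otherwise `v b r c w` and a path through the component of `a` would create a long induced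
  -- cycle. Taking `r = p` and `r = q` excludes the chords `cp` and `bq`.
  have hcommon : ∀ r, r ∉ C → G.Adj b r → G.Adj c r → G.Touches C r a := by
    intro r hrC hbr hcr
    by_contra hra
    refine hG.false_of_two_paths (X := {x ∈ C | (G.restrictTo C).Reachable a x})
      (Y := {b, r, c}) hvw (hind hvC hwC) ?_ ?_ ?_ ?_
    · rintro x ⟨hx, hax⟩ (rfl | rfl | rfl)
      · exact hab hax
      · exact hrC hx
      · exact hac hax
    · rintro x ⟨hx, hax⟩ y (rfl | rfl | rfl) hxy
      · exact hab (hax.trans (hone hx hb hxy))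
      · exact hra ⟨x, hx, hax, hxy.symm⟩
      · exact hac (hax.trans (hone hx hc hxy))
    · exact (hva.reachable_restrictTo (by simp) fun x hx h => by simp [hx, h]).trans
        (hwa.reachable_restrictTo (by simp) fun x hx h => by simp [hx, h]).symm
    · have h1 : (G.restrictTo (insert v (insert w {b, r, c}))).Reachable v v := .rfl
      have h2 := reachable_restrictTo_trans_adj h1 hvb (by simp) (by simp)
      have h3 := reachable_restrictTo_trans_adj h2 hbr (by simp) (by simp)
      have h4 := reachable_restrictTo_trans_adj h3 hcr.symm (by simp) (by simp)
      exact reachable_restrictTo_trans_adj h4 hwc.symm (by simp) (by simp)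
  have hcp : ¬ G.Adj c p := fun hcp => hpa (hcommon p hpC hbp hcp)
  have hbq : ¬ G.Adj b q := fun hbq => hqa (hcommon q hqC hbq hcq)
  have hbc' : ¬ G.Adj b c := fun h => hbc (hone hb hc h)
  obtain ⟨A, hA⟩ : ∃ A : Set V, A = {x ∈ C | (G.restrictTo C).Reachable a x} := ⟨_, rfl⟩
  have hAC : A ⊆ C := fun x hx => by rw [hA] at hx; exact hx.1
  have hAb : ∀ x ∈ A, ¬ G.Adj x b ∧ ¬ G.Adj x c ∧ ¬ G.Adj x p ∧ ¬ G.Adj x q ∧ x ≠ b ∧ x ≠ c := by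
    intro x hx
    rw [hA] at hx
    refine ⟨fun h => hab (hx.2.trans (hone hx.1 hb h)), fun h => hac (hx.2.trans (hone hx.1 hc h)),
      fun h => hpa ⟨x, hx.1, hx.2, h.symm⟩, fun h => hqa ⟨x, hx.1, hx.2, h.symm⟩, ?_, ?_⟩
    · rintro rfl
      exact hab hx.2
    · rintro rfl
      exact hac hx.2
  have hreach : (G.restrictTo (A ∪ {p, b, v, w, c, q})).Reachable p q := by
    have h1 : (G.restrictTo (A ∪ {p, b, v, w, c, q})).Reachable p p := .rfl
    have h2 := reachable_restrictTo_trans_adj h1 hbp.symm (by simp) (by simp)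
    have h3 := reachable_restrictTo_trans_adj h2 hvb.symm (by simp) (by simp)
    have h4 := h3.trans ((hva.reachable_restrictTo (by simp)
      fun x hx h => by simp [hA, hx, h]).trans
      (hwa.reachable_restrictTo (by simp) fun x hx h => by simp [hA, hx, h]).symm)
    have h5 := reachable_restrictTo_trans_adj h4 hwc (by simp) (by simp)
    exact reachable_restrictTo_trans_adj h5 hcq (by simp) (by simp)
  have hnpq := hind hpC hqC
  have hnpv := hind hpC hvC
  have hnpw := hind hpC hwC
  have hnqv := hind hqC hvC
  have hnqw := hind hqC hwC
  have hnvw := hind hvC hwC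
  have hpv : p ≠ v := fun h => hp (h ▸ hv)
  have hpw : p ≠ w := fun h => hp (h ▸ hw)
  have hqv : q ≠ v := fun h => hq (h ▸ hv)
  have hqw : q ≠ w := fun h => hq (h ▸ hw)
  have hpq : p ≠ q := fun h => hcp (h ▸ hcq)
  have hne : b ≠ c := fun h => hbc (h ▸ .rfl)
  have hCne : ∀ {s t}, s ∈ C → t ∉ C → s ≠ t := fun hs ht h => ht (h ▸ hs)
  -- The levels follow `p, b, v, A, w, c, q`; on the set considered, the default 3 is `A`.
  let φ : V → ℕ := fun z => if z = p then 0 else if z = b then 1 else if z = v then 2 else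
    if z = w then 4 else if z = c then 5 else if z = q then 6 else 3
  have hφp : φ p = 0 := by simp [φ]
  have hφb : φ b = 1 := by simp [φ, hCne hb hpC]
  have hφv : φ v = 2 := by simp [φ, hpv.symm, (hCne hb hvC).symm]
  have hφw : φ w = 4 := by simp [φ, hpw.symm, (hCne hb hwC).symm, Ne.symm hvw]
  have hφc : φ c = 5 := by simp [φ, hCne hc hpC, hne.symm, hCne hc hvC, hCne hc hwC]
  have hφq : φ q = 6 := by
    simp [φ, hpq.symm, (hCne hb hqC).symm, hqv, hqw, (hCne hc hqC).symm]
  have hφA : ∀ x ∈ A, φ x = 3 := fun x hx => by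
    obtain ⟨-, -, -, -, h1, h2⟩ := hAb x hx
    have hxC := hAC hx
    simp [φ, h1, h2, hCne hxC hpC, hCne hxC hvC, hCne hxC hwC, hCne hxC hqC]
  clear_value φ
  refine hP7.false_of_levels hreach (by simp) φ ?_ (by omega)
  rintro s hs t ht hst
  have hts := hst.symm
  rcases hs with hs | rfl | rfl | rfl | rfl | rfl | rfl <;>
  rcases ht with ht | rfl | rfl | rfl | rfl | rfl | rfl <;>
  first
  | omega
  | contradiction
  | exact absurd hst (hAb _ hs).1
  | exact absurd hts (hAb _ ht).1
  | exact absurd hst (hAb _ hs).2.1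
  | exact absurd hts (hAb _ ht).2.1
  | exact absurd hst (hAb _ hs).2.2.1
  | exact absurd hts (hAb _ ht).2.2.1
  | exact absurd hst (hAb _ hs).2.2.2.1
  | exact absurd hts (hAb _ ht).2.2.2.1
  | grind

/-- Every additional vertex of an optimal extension is adjacent to a component of the vertex cover
outside the central one. -/
theorem IsOptimalExtension.exists_touches_not_reachable [Finite V]
    (h : G.IsOptimalExtension C D) {v a : V} (hv : v ∈ D) (hvC : v ∉ C) (ha : a ∈ C)
    (hva : G.Reachable v a) :
    ∃ c ∈ C, ¬ (G.restrictTo C).Reachable a c ∧ G.Touches C v c := by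
  have hC := h.cover
  by_contra! hcon
  obtain ⟨s, hs, hsv, hvs, hsa⟩ := h.exists_separated hv hvC a
  have hCv : C ⊆ D \ {v} := fun c hc => ⟨h.subset hc, fun hcv => hvC (hcv ▸ hc)⟩
  -- If `v` touched only the component of `a`, a walk leaving `v` would land in that component, so
  -- deleting `v` could not cut `s` off from `a`.
  have key := (h.conn.2 a (h.subset ha) s hs (hva.symm.trans hvs)).invariant
    (P := fun z => z = v ∨ (G.restrictTo (D \ {v})).Reachable z a) (Or.inr .rfl) ?_
  · exact key.elim hsv hsa
  · rintro x y hxy hx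
    by_cases hyv : y = v
    · exact Or.inl hyv
    refine Or.inr ?_
    by_cases hxv : x = v
    · subst hxv
      have hy := hC.touches_of_adj hvC hxy.1
      by_contra hya
      exact hcon y (hC.mem_of_adj hvC hxy.1)
        (fun hay => hya (hay.mono (restrictTo_mono hCv)).symm) hy
    · have hyx : (G.restrictTo (D \ {v})).Adj y x := ⟨hxy.1.symm, ⟨hxy.2.2, hyv⟩, ⟨hxy.2.1, hxv⟩⟩
      exact hyx.reachable.trans (hx.resolve_left hxv)

/-! ### Counting in each component of the graph. -/

open Classical in
/-- Within each component of a chordal `P₇`-free graph, an optimal extension adds at most half as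
many vertices as the vertex cover has. -/
theorem IsOptimalExtension.two_mul_card_le [Fintype V] (h : G.IsOptimalExtension C D)
    (hG : G.IsChordal) (hP7 : G.IndFree (pathGraph 7)) (K : G.ConnectedComponent) :
    2 * (Finset.univ.filter fun v => (v ∈ D ∧ v ∉ C) ∧ G.connectedComponentMk v = K).card ≤
      (Finset.univ.filter fun v => v ∈ C ∧ G.connectedComponentMk v = K).card := by
  have hC := h.cover
  set J := Finset.univ.filter fun v => (v ∈ D ∧ v ∉ C) ∧ G.connectedComponentMk v = K with hJ
  rcases J.eq_empty_or_nonempty with hJ0 | ⟨v₀, hv₀⟩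
  · simp [hJ0]
  have hmem : ∀ v ∈ J, v ∈ D ∧ v ∉ C ∧ G.connectedComponentMk v = K := by
    intro v hv
    simpa [hJ, and_assoc] using hv
  obtain ⟨hv₀D, hv₀C, hv₀K⟩ := hmem v₀ hv₀
  obtain ⟨a, ha, hcenter⟩ := h.exists_center hG hP7 hv₀D hv₀C
  have hreach : ∀ v ∈ J, G.Reachable v₀ v := fun v hv =>
    ConnectedComponent.exact (hv₀K.trans (hmem v hv).2.2.symm)
  have htouch : ∀ v ∈ J, G.Touches C v a := fun v hv =>
    hcenter v (hmem v hv).1 (hmem v hv).2.1 (hreach v hv)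
  let A := Finset.univ.filter fun c => c ∈ C ∧ (G.restrictTo C).Reachable a c
  let W : V → Finset V := fun v =>
    Finset.univ.filter fun c => c ∈ C ∧ ¬ (G.restrictTo C).Reachable a c ∧ G.Touches C v c
  have hWmem : ∀ v c, c ∈ W v ↔ c ∈ C ∧ ¬ (G.restrictTo C).Reachable a c ∧ G.Touches C v c := by
    simp [W]
  have hWdisj : (J : Set V).PairwiseDisjoint W := by
    intro v hv w hw hvw
    refine Finset.disjoint_left.2 fun c hcv hcw => hvw ?_
    rw [hWmem] at hcv hcw
    exact hG.eq_of_touches hC (hmem v hv).2.1 (hmem w hw).2.1 hcv.2.1 (htouch v hv) (htouch w hw)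
      hcv.2.2 hcw.2.2
  have hWpos : ∀ v ∈ J, 1 ≤ (W v).card := by
    intro v hv
    obtain ⟨c, hc⟩ := h.exists_touches_not_reachable (hmem v hv).1 (hmem v hv).2.1 ha
      (htouch v hv).reachable
    exact Finset.card_pos.2 ⟨c, (hWmem v c).2 hc⟩
  have hpendant : ∀ v ∈ J, (W v).card = 1 → ∃ b ∈ C, ¬ (G.restrictTo C).Reachable a b ∧
      G.Adj v b ∧ ∃ p, p ∉ D ∧ G.Adj b p := by
    intro v hv hcard
    obtain ⟨b, hb⟩ := Finset.card_eq_one.1 hcard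
    obtain ⟨hbC, hab, hvb⟩ := (hWmem v b).1 (by simp [hb])
    refine ⟨b, hbC, hab, h.exists_pendant hG (hmem v hv).1 (hmem v hv).2.1
      (fun u hu huC hvu => hcenter u hu huC ((hreach v hv).trans hvu)) hbC hab hvb
      fun c hc hac hvc => ?_⟩
    simpa [hb] using (hWmem v c).2 ⟨hc, hac, hvc⟩
  have hbad : (J.filter fun v => (W v).card = 1).card ≤ 1 := by
    refine Finset.card_le_one.2 fun v hv w hw => ?_
    rw [Finset.mem_filter] at hv hw
    obtain ⟨b, hb, hab, hvb, p, hp, hbp⟩ := hpendant v hv.1 hv.2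
    obtain ⟨c, hc, hac, hwc, q, hq, hcq⟩ := hpendant w hw.1 hw.2
    exact hG.eq_of_pendant hP7 hC h.subset (hmem v hv.1).1 (hmem v hv.1).2.1 (hmem w hw.1).1
      (hmem w hw.1).2.1 (htouch v hv.1) (htouch w hw.1) hb hc hab hac hvb hwc hp hbp hq hcq
  -- Each `v` contributes at least 2: its `W v` is nonempty, and singletons get a bonus of 1. By
  -- `hbad` the total bonus is at most 1, which `A` covers.
  have hsum : 2 * J.card ≤ ∑ v ∈ J, (W v).card + (J.filter fun v => (W v).card = 1).card := by
    rw [Finset.card_filter (fun v => (W v).card = 1) J, ← Finset.sum_add_distrib,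
      mul_comm, ← smul_eq_mul]
    refine Finset.card_nsmul_le_sum J _ 2 fun v hv => ?_
    have := hWpos v hv
    split_ifs <;> omega
  have hA : 1 ≤ A.card := Finset.card_pos.2 ⟨a, by simp [A, ha]⟩
  have hAW : Disjoint A (J.biUnion W) := by
    refine Finset.disjoint_left.2 fun c hcA hcW => ?_
    obtain ⟨v, -, hv⟩ := Finset.mem_biUnion.1 hcW
    exact ((hWmem v c).1 hv).2.1 (by simpa [A] using (Finset.mem_filter.1 hcA).2.2)
  have hsub : A ∪ J.biUnion W ⊆
      Finset.univ.filter fun v => v ∈ C ∧ G.connectedComponentMk v = K := by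
    intro c hc
    rw [Finset.mem_filter]
    refine ⟨Finset.mem_univ c, ?_⟩
    rcases Finset.mem_union.1 hc with hc | hc
    · obtain ⟨-, hcC, hac⟩ := Finset.mem_filter.1 hc
      exact ⟨hcC, (ConnectedComponent.sound
        ((htouch v₀ hv₀).reachable.trans (hac.mono (restrictTo_le _))).symm).trans hv₀K⟩
    · obtain ⟨v, hv, hc⟩ := Finset.mem_biUnion.1 hc
      obtain ⟨hcC, -, hvc⟩ := (hWmem v c).1 hc
      exact ⟨hcC, (ConnectedComponent.sound hvc.reachable.symm).trans (hmem v hv).2.2⟩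
  have hcard := Finset.card_le_card hsub
  rw [Finset.card_union_of_disjoint hAW, Finset.card_biUnion hWdisj] at hcard
  omega

open Classical in
theorem IsOptimalExtension.two_mul_ncard_le [Finite V] (h : G.IsOptimalExtension C D)
    (hG : G.IsChordal) (hP7 : G.IndFree (pathGraph 7)) : 2 * D.ncard ≤ 3 * C.ncard := by
  have := Fintype.ofFinite V
  have hfib : ∀ (p : V → Prop) [DecidablePred p], (Finset.univ.filter p).card =
      ∑ K : G.ConnectedComponent,
        (Finset.univ.filter fun v => p v ∧ G.connectedComponentMk v = K).card := by
    intro p _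
    rw [Finset.card_eq_sum_card_fiberwise (f := G.connectedComponentMk) (t := Finset.univ)
      (fun _ _ => by simp)]
    simp only [Finset.filter_filter]
  have hle : 2 * (Finset.univ.filter fun v => v ∈ D ∧ v ∉ C).card ≤
      (Finset.univ.filter fun v => v ∈ C).card := by
    rw [hfib, hfib, Finset.mul_sum]
    exact Finset.sum_le_sum fun K _ => h.two_mul_card_le hG hP7 K
  have hdiff : (D \ C).ncard = (Finset.univ.filter fun v => v ∈ D ∧ v ∉ C).card := by
    rw [← Set.ncard_coe_finset]
    congr 1
    ext
    simp
  have hcover : C.ncard = (Finset.univ.filter fun v => v ∈ C).card := by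
    rw [← Set.ncard_coe_finset]
    congr 1
    ext
    simp
  have := Set.ncard_sdiff_add_ncard_of_subset h.subset
  omega

/-! ### From optimal extensions to connected vertex covers. -/

theorem reachable_induce_iff {x y : V} (hx : x ∈ D) (hy : y ∈ D) :
    (G.induce D).Reachable ⟨x, hx⟩ ⟨y, hy⟩ ↔ (G.restrictTo D).Reachable x y := by
  constructor
  · intro h
    exact h.map (G' := G.restrictTo D)
      ⟨Subtype.val, fun {s t} hst => ⟨hst, s.2, t.2⟩⟩
  · intro h
    refine (h.invariant (P := fun z => ∃ hz : z ∈ D,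
      (G.induce D).Reachable ⟨x, hx⟩ ⟨z, hz⟩) ⟨hx, .rfl⟩ ?_).2
    rintro s t hst ⟨hs, h⟩
    have : (G.induce D).Adj ⟨s, hs⟩ ⟨t, hst.2.2⟩ := hst.1
    exact ⟨hst.2.2, h.trans this.reachable⟩

theorem restrictTo_support : G.restrictTo G.support = G := by
  ext s t
  exact ⟨And.left, fun h => ⟨h, h.mem_support_left, h.symm.mem_support_left⟩⟩

theorem isComponentwiseConnected_support : G.IsComponentwiseConnected G.support :=
  ⟨subset_rfl, fun _ _ _ _ h => by rwa [restrictTo_support]⟩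

/-- Inclusion into the support induces a bijection on components: connectedness gives injectivity,
and covering an edge at each non-isolated vertex gives surjectivity. -/
theorem IsComponentwiseConnected.isConnectedVertexCover (h : G.IsComponentwiseConnected D)
    (hD : G.IsVertexCover D) : G.IsConnectedVertexCover D := by
  refine ⟨hD, Nat.card_eq_of_bijective
    (ConnectedComponent.map (G.induceHomOfLE h.1).toHom) ⟨?_, ?_⟩⟩
  · refine ConnectedComponent.ind₂ fun ⟨x, hx⟩ ⟨y, hy⟩ hxy => ?_
    have hr := ConnectedComponent.exact hxy
    refine ConnectedComponent.sound ((reachable_induce_iff hx hy).2 (h.2 x hx y hy ?_))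
    exact ((reachable_induce_iff (h.1 hx) (h.1 hy)).1 hr).mono (restrictTo_le _)
  · refine ConnectedComponent.ind fun ⟨x, hx⟩ => ?_
    obtain ⟨y, hxy⟩ := id hx
    rcases hD hxy with hxD | hyD
    · exact ⟨(G.induce D).connectedComponentMk ⟨x, hxD⟩, rfl⟩
    · refine ⟨(G.induce D).connectedComponentMk ⟨y, hyD⟩, ConnectedComponent.sound ?_⟩
      have : (G.induce G.support).Adj ⟨y, h.1 hyD⟩ ⟨x, hx⟩ := hxy.symm
      exact this.reachable

theorem exists_isOptimalExtension [Finite V] (G : SimpleGraph V) :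
    ∃ C D, G.IsOptimalExtension C D ∧ C.encard = G.vertexCoverNum := by
  obtain ⟨C₀, hcard, hC₀⟩ := G.vertexCoverNum_exists
  -- A minimum cover contains no isolated vertex, so the support is an admissible `D` and the
  -- minimisation is over a nonempty family.
  have hsupp : C₀ ⊆ G.support := by
    intro x hx
    by_contra hxs
    have hcover : G.IsVertexCover (C₀ \ {x}) := by
      intro s t hst
      have h1 := hst.mem_support_left
      have h2 := hst.symm.mem_support_left
      have h3 := hC₀ hst
      grind
    have hlt := (Set.toFinite (C₀ \ {x})).encard_lt_encard
      (Set.sdiff_singleton_ssubset.2 hx)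
    exact absurd hcover.vertexCoverNum_le (not_le.2 (hcard ▸ hlt))
  obtain ⟨D, ⟨⟨C, hC, hCcard, hCD⟩, hD⟩, hmin⟩ := Set.exists_min_image
    {D : Set V | (∃ C, G.IsVertexCover C ∧ C.ncard = C₀.ncard ∧ C ⊆ D) ∧
      G.IsComponentwiseConnected D} Set.ncard (Set.toFinite _)
    ⟨G.support, ⟨C₀, hC₀, rfl, hsupp⟩, isComponentwiseConnected_support⟩
  refine ⟨C, D, ⟨hC, hCD, hD, fun C' D' h1 h2 h3 h4 =>
    hmin D' ⟨⟨C', h1, h2.trans hCcard, h3⟩, h4⟩⟩, ?_⟩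
  rw [← hcard, ← (Set.toFinite C).cast_ncard_eq, ← (Set.toFinite C₀).cast_ncard_eq, hCcard]

theorem IndFree.induce {W : Type*} {H : SimpleGraph W} (h : G.IndFree H) (S : Set V) :
    (G.induce S).IndFree H := fun hH => h (hH.trans ⟨Embedding.induce S⟩)

end

end SimpleGraph

theorem corollary1 {V : Type*} [Finite V] (G : SimpleGraph V)
    (hchordal : G.IsChordal) (hP7 : G.IndFree (SimpleGraph.pathGraph 7)) (S : Set V) :
    ((G.induce S).connectedVertexCoverNum : ℝ≥0∞) ≤
      3 / 2 * ((G.induce S).vertexCoverNum : ℝ≥0∞) := by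
  obtain ⟨C, D, hopt, hC⟩ := (G.induce S).exists_isOptimalExtension
  -- Both hypotheses are hereditary, so the bound applies to `G.induce S` itself.
  have hle := hopt.two_mul_ncard_le (fun n hn => (hchordal n hn).induce S) (hP7.induce S)
  have hcov := hopt.conn.isConnectedVertexCover (hopt.cover.subset hopt.subset)
  have h1 : (G.induce S).connectedVertexCoverNum ≤ (D.ncard : ℕ∞) := by
    rw [(Set.toFinite D).cast_ncard_eq]
    exact iInf₂_le D hcov
  rw [← hC, ← (Set.toFinite C).cast_ncard_eq, ENat.toENNReal_coe]
  refine (ENat.toENNReal_mono h1).trans ?_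
  rw [ENat.toENNReal_coe, mul_comm, ← mul_div_assoc, ENNReal.le_div_iff_mul_le (by simp) (by simp)]
  exact_mod_cast (by omega : D.ncard * 2 ≤ C.ncard * 3)
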